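/- **Setting.** A (finite, simple, undirected) link stream $L=(T,V,E)$ consists of a time interval $T\subset\mathbb R$, a node set $V$ and a finite set $E$ of links $(b,e,u,v)$ with $b\le e$ in $T$ and $u\ne v$ in $V$; $(b,e,u,v)$ and $(b,e,v,u)$ are the same link, and the intervals $[b,e]$ of two distinct links on the same pair of nodes are disjoint. $G_t$ is the graph on $V$ whose edges $\{u,v\}$ are the pairs with a link $(b,e,u,v)\in E$, $t\in[b,e]$; $N_t$ denotes its neighbourhoods, the end time of that edge is $e$, and the final time $\mathcal E_t(C)$ of a clique $C$ of $G_t$ is the minimum of the end times of its edges. A clique of $L$ is a pair $(C,[t_0,t_1])$ with $C\subseteq V$, $|C|\ge 2$, $t_0\le t_1$ in $T$, such that any two distinct nodes of $C$ are joined by a link $(b,e,u,v)$ with $[t_0,t_1]\subseteq[b,e]$; it is maximal if no clique $(C,I)$ of $L$ has $I\supsetneq[t_0,t_1]$ and no clique $(C',[t_0,t_1])$ of $L$ has $C'\supsetneq C$. Let $\alpha$ be the number of maximal cliques of $L$, $q$ the maximal number of nodes of a clique of $L$, and $d$ the maximal degree of a vertex in the graphs $G_t$, $t\in T$. **Algorithm.**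 For each instant $t$ at which a link begins or ends, put $\mathit{Cliques}=F=\emptyset$; for each link $(t,\cdot,u,v)\in E$ beginning at $t$, add to $\mathit{Cliques}$ the pairs output by $\mathrm{GCE}(\{u,v\},N_t(u)\cap N_t(v),\emptyset,F,t)$, then add $\{u,v\}$ to $F$. Then, for each $(C,N)\in\mathit{Cliques}$, output $(C,[t,\mathcal E_t(C)])$ if $\mathcal E_t(C\cup\{u\})<\mathcal E_t(C)$ for all $u\in N$. The recursive procedure $\mathrm{GCE}(R,P,X,F,t)$ outputs the pair $(R,P\cup X)$, computes $Q=\{u\in P:\exists v\in R,\ \{u,v\}\in F\}$, and for each $u\in P\setminus Q$ calls $\mathrm{GCE}(R\cup\{u\},P\cap N_t(u),X\cap N_t(u),F,t)$ and then moves $u$ from $P$ to $X$. In the version with a pivot, each call with $P\cup X\neq\emptyset$ computes $\mathrm{Del}_p=\{u\in P\cap N_t(p):\mathcal E_t(R\cup\{u\})=\mathcal E_t(R\cup\{u,p\})\}$ for all $p\in P\cup X$, chooses a pivot $p\in P\cup X$ by any rule, and its loop runs over $(P\setminus \mathrm{Del}_p)\setminus Q$ only. All loops may run in any order. The running time is the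 number of elementary steps: reading or writing a list cell, comparing two nodes or times, taking a minimum of two times, testing or inserting an edge in $F$, and one direct access to the data structure storing $L$ (the list of instants, the list of the links beginning at $t$, the list $N_t(u)$, or the end time of $\{u,v\}$ in $G_t$, including whether it is an edge). Choosing a pivot among the computed pairs $(p,\mathrm{Del}_p)$ counts one step per pair. The calls of $\mathrm{GCE}$ form a forest, whose leaves are the calls that make no recursive call. Let $r$ be the number of leaves whose output $(C,N)$ is such that $(C,[t,\mathcal E_t(C)])$ is a maximal clique of $L$, divided by the total number of leaves. **Theorem (output-sensitive complexity).** For every link stream $L$ with at least one link, and for the algorithm without a pivot as well as with a pivot, $$1\le \frac1r\le 2^q .$$ Moreover the running time is in $O\!\left(\frac1r\cdot d^2\cdot q\cdot\alpha\right)$: there is an absolute constant $c$ such that on every link stream with at least one link the algorithm, in either version, takes at most $c\cdot\frac1r\cdot d^2\cdot q\cdot\alpha$ steps. -/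

import Mathlib

/-! ### Link streams and their cliques -/

/-- A link between two nodes `u` and `v`, present during the time interval `[b, e]`. -/
structure Link (V : Type*) where
  b : ℝ
  e : ℝ
  u : V
  v : V

namespace Link

variable {V : Type*}

/-- The link joins the (unordered) pair `x`, `y`: links are undirected. -/
def Joins (l : Link V) (x y : V) : Prop :=
  (l.u = x ∧ l.v = y) ∨ (l.u = y ∧ l.v = x)

/-- The time interval `[b, e]` of a link. -/
def interval (l : Link V) : Set ℝ := Set.Icc l.b l.e

end Link

/-- A finite simple undirected link stream on the node set `V`, over the time interval
`[start, finish]`. Every undirected link is stored once, in one of its two orientations (`simple`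
excludes that both orientations of a link are stored). -/
structure LinkStream (V : Type*) where
  start : ℝ
  finish : ℝ
  E : Finset (Link V)
  start_le : ∀ l ∈ E, start ≤ l.b
  le_finish : ∀ l ∈ E, l.e ≤ finish
  b_le_e : ∀ l ∈ E, l.b ≤ l.e
  loopless : ∀ l ∈ E, l.u ≠ l.v
  simple : ∀ l ∈ E, ∀ l' ∈ E, l ≠ l' → l'.Joins l.u l.v → Disjoint l.interval l'.interval

namespace LinkStream

variable {V : Type*} (L : LinkStream V)

/-- `(C, [t₀, t₁])` is a clique of the link stream. -/
def IsClique (C : Finset V) (t₀ t₁ : ℝ) : Prop :=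
  2 ≤ C.card ∧ L.start ≤ t₀ ∧ t₀ ≤ t₁ ∧ t₁ ≤ L.finish ∧
    ∀ u ∈ C, ∀ v ∈ C, u ≠ v → ∃ l ∈ L.E, l.Joins u v ∧ Set.Icc t₀ t₁ ⊆ l.interval

/-- A clique that cannot be extended in time. -/
def IsTimeMaximal (C : Finset V) (t₀ t₁ : ℝ) : Prop :=
  L.IsClique C t₀ t₁ ∧
    ¬ ∃ t₀' t₁' : ℝ, L.IsClique C t₀' t₁' ∧ Set.Icc t₀ t₁ ⊂ Set.Icc t₀' t₁'

/-- A clique that cannot be extended in vertices. -/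
def IsVertexMaximal (C : Finset V) (t₀ t₁ : ℝ) : Prop :=
  L.IsClique C t₀ t₁ ∧ ¬ ∃ C' : Finset V, L.IsClique C' t₀ t₁ ∧ C ⊂ C'

/-- A maximal clique: both time-maximal and vertex-maximal. -/
def IsMaximalClique (C : Finset V) (t₀ t₁ : ℝ) : Prop :=
  L.IsTimeMaximal C t₀ t₁ ∧ L.IsVertexMaximal C t₀ t₁

/-- The number `α` of maximal cliques. -/
noncomputable def numMaximalCliques : ℕ :=
  {x : Finset V × ℝ × ℝ | L.IsMaximalClique x.1 x.2.1 x.2.2}.ncard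

/-- The maximal number `q` of vertices in a clique. -/
noncomputable def maxCliqueSize : ℕ :=
  sSup {k : ℕ | ∃ (C : Finset V) (t₀ t₁ : ℝ), L.IsClique C t₀ t₁ ∧ C.card = k}

/-- The instantaneous graph `G_t`. -/
def graphAt (t : ℝ) : SimpleGraph V where
  Adj u v := ∃ l ∈ L.E, l.Joins u v ∧ t ∈ l.interval
  symm := ⟨fun _ _ ⟨l, hl, hj, ht⟩ => ⟨l, hl, Or.symm hj, ht⟩⟩
  loopless := ⟨fun _ ⟨l, hl, hj, _⟩ =>
    L.loopless l hl (hj.elim (fun h => h.1.trans h.2.symm) (fun h => h.1.trans h.2.symm))⟩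

/-- The maximal degree `d` of a vertex in an instantaneous graph. -/
noncomputable def maxDegree : ℕ :=
  sSup {k : ℕ | ∃ t ∈ Set.Icc L.start L.finish, ∃ u : V, ((L.graphAt t).neighborSet u).ncard = k}

/-- The end time of the edge `{u, v}` of `G_t`, that is, the end of the unique link joining `u`
and `v` that is present at time `t`. The value is `⊤` if `{u, v}` is not an edge of `G_t`. -/
noncomputable def endTime (t : ℝ) (u v : V) : WithTop ℝ := by
  classical
  exact (L.E.filter fun l => l.Joins u v ∧ t ∈ l.interval).inf fun l => (l.e : WithTop ℝ)

/-- The final time of a clique `C` of `G_t`: the minimum of the end times of its edges. (Terms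
with `u = v` are `⊤` and do not contribute.) -/
noncomputable def finalTime (t : ℝ) (C : Finset V) : WithTop ℝ :=
  C.inf fun u => C.inf fun v => L.endTime t u v

end LinkStream

/-! ### Step counting

A value of type `Timed α` is the result of a computation together with the number of elementary
steps it took. Elementary steps are: reading or writing a list cell, comparing two nodes or two
numbers, taking the minimum of two numbers, testing or inserting an element of a dictionary of
edges, and one direct access to the data structure that stores the link stream. -/

/-- A result together with the number of elementary steps spent on computing it. -/
structure Timed (α : Type*) where
  val : α
  steps : ℕ

namespace Timed

variable {α β : Type*}

/-- An elementary step with result `a`. -/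
def step (a : α) : Timed α := ⟨a, 1⟩

/-- Run `x`, then run `f` on its result; the numbers of steps add up. -/
def bind (x : Timed α) (f : α → Timed β) : Timed β :=
  ⟨(f x.val).val, x.steps + (f x.val).steps⟩

/-- The sublist of the elements that pass the test `p`. -/
def filter (p : α → Timed Bool) : List α → Timed (List α)
  | [] => step []
  | a :: l =>
    (filter p l).bind fun l' =>
    (p a).bind fun b =>
    step (if b then a :: l' else l')

/-- Apply `f` to every element. -/
def map (f : α → Timed β) : List α → Timed (List β)
  | [] => step []
  | a :: l =>
    (map f l).bind fun l' =>
    (f a).bind fun b =>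
    step (b :: l')

/-- Does some element pass the test `p`? -/
def any (p : α → Timed Bool) : List α → Timed Bool
  | [] => step false
  | a :: l =>
    (any p l).bind fun r =>
    (p a).bind fun b =>
    step (b || r)

/-- Do all elements pass the test `p`? -/
def all (p : α → Timed Bool) : List α → Timed Bool
  | [] => step true
  | a :: l =>
    (all p l).bind fun r =>
    (p a).bind fun b =>
    step (b && r)

/-- Concatenation, copying the first list. -/
def append (l₁ l₂ : List α) : Timed (List α) :=
  match l₁ with
  | [] => step l₂
  | a :: l =>
    (append l l₂).bind fun r =>
    step (a :: r)

/-- `l₁ \ l₂` -/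
def diff [DecidableEq α] (l₁ l₂ : List α) : Timed (List α) :=
  filter (fun a =>
    (any (fun x => step (decide (x = a))) l₂).bind fun b =>
    step (!b)) l₁

/-- `l \ {a}` -/
def remove [DecidableEq α] (a : α) (l : List α) : Timed (List α) :=
  filter (fun x => step (decide (x ≠ a))) l

end Timed

/-! ### The enumeration algorithm -/

/-- One call `GCE(R, P, X, …)` of the recursive procedure: it outputs the clique `R` with its
neighbourhood `N = P ∪ X`. The flag `isLeaf` records whether the call makes no recursive call. -/
structure Call (V : Type*) where
  R : List V
  N : List V
  isLeaf : Bool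

/-- Everything that the pseudocode leaves open: how the sets of the link stream are listed by its
data structure, in which order the loops run, and whether and how pivots are chosen. All of these
may be arbitrary. -/
structure Implementation {V : Type*} (L : LinkStream V) where
  /-- the instants at which some link begins or ends, in any order -/
  times : List ℝ
  times_nodup : times.Nodup
  mem_times : ∀ t, t ∈ times ↔ ∃ l ∈ L.E, t = l.b ∨ t = l.e
  /-- the links that begin at a given instant, in any order -/
  starting : ℝ → List (Link V)
  starting_nodup : ∀ t, (starting t).Nodup
  mem_starting : ∀ t l, l ∈ starting t ↔ l ∈ L.E ∧ l.b = t
  /-- the neighbourhoods in the instantaneous graphs, in any order -/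
  nbrs : ℝ → V → List V
  nbrs_nodup : ∀ t u, (nbrs t u).Nodup
  mem_nbrs : ∀ t u w, w ∈ nbrs t u ↔ (L.graphAt t).Adj u w
  /-- the order in which the call with clique `R` at time `t` runs through its candidates -/
  order : ℝ → List V → List V → List V
  order_perm : ∀ t R l, (order t R l).Perm l
  /-- `none` is the algorithm without a pivot; otherwise, the rule by which the call with clique
  `R` at time `t` selects one of the pairs `(p, Del)`, where `p` runs through `P ∪ X` and `Del` is
  the set of vertices that the pivot `p` allows to skip -/
  pivot : Option (ℝ → List V → List (V × List V) → V × List V)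
  pivot_mem : ∀ f ∈ pivot, ∀ t R c, c ≠ [] → f t R c ∈ c

namespace Implementation

open Timed

variable {V : Type*} [DecidableEq V] {L : LinkStream V} (A : Implementation L)

/-- Is `w` a neighbour of `u` in `G_t`? -/
noncomputable def isNbr (L : LinkStream V) (t : ℝ) (u w : V) : Timed Bool :=
  step (decide (L.endTime t u w ≠ ⊤))

/-- The minimum of the end times of the edges of `G_t` from `u` to the elements of a list. -/
noncomputable def minEnd (L : LinkStream V) (t : ℝ) (u : V) : List V → Timed (WithTop ℝ)
  | [] => step ⊤
  | v :: l =>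
    (minEnd L t u l).bind fun m =>
    (step (L.endTime t u v)).bind fun e =>
    step (min e m)

/-- The final time of a clique of `G_t` given as a list. -/
noncomputable def cliqueEnd (L : LinkStream V) (t : ℝ) : List V → Timed (WithTop ℝ)
  | [] => step ⊤
  | u :: l =>
    (cliqueEnd L t l).bind fun m =>
    (minEnd L t u l).bind fun e =>
    step (min e m)

/-- The pairs `(w, final time of R ∪ {w})` for `w` in `W`, where `eR` is the final time of `R`. -/
noncomputable def extensionEnds (L : LinkStream V) (t : ℝ) (R : List V) (eR : WithTop ℝ)
    (W : List V) : Timed (List (V × WithTop ℝ)) :=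
  Timed.map (fun w =>
    (minEnd L t w R).bind fun m =>
    (step (min m eR)).bind fun e =>
    step (w, e)) W

/-- The pair `(p, Del)` for a possible pivot `p`, where
`Del = {u ∈ P ∩ N_t(p) | final time of R ∪ {u} = final time of R ∪ {u, p}}`.
Here `p` and the elements `u` of `P` come with the final times of `R ∪ {p}` and `R ∪ {u}`, and
the final time of `R ∪ {u, p}` is the minimum of these two and of the end time of `{u, p}`. -/
noncomputable def deletable (L : LinkStream V) (t : ℝ) (P : List (V × WithTop ℝ))
    (p : V × WithTop ℝ) : Timed (V × List V) :=
  (Timed.filter (fun u =>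
    (step (L.endTime t u.1 p.1)).bind fun e =>
    (step (decide (e ≠ ⊤))).bind fun b =>
    (step (min u.2 p.2)).bind fun e' =>
    (step (min e' e)).bind fun e'' =>
    (step (decide (u.2 = e''))).bind fun b' =>
    step (b && b')) P).bind fun D =>
  (Timed.map (fun u => step u.1) D).bind fun D' =>
  step (p.1, D')

/-- The set `Del` of the candidates skipped thanks to the selected pivot; it is empty if no
pivoting is used or if `P ∪ X` is empty. -/
noncomputable def del (t : ℝ) (R P X : List V) : Timed (List V) :=
  match A.pivot with
  | none => step []
  | some rule =>
    (cliqueEnd L t R).bind fun eR =>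
    (extensionEnds L t R eR P).bind fun P' =>
    (extensionEnds L t R eR X).bind fun X' =>
    (Timed.append P' X').bind fun W =>
    (Timed.map (deletable L t P') W).bind fun c =>
    -- one pass over the possible pivots to apply the rule
    (Timed.map step c).bind fun c' =>
    step (if c' = [] then [] else (rule t R c').2)

/-- The loop of a call `GCE(R, P, X, …)` over the list of the vertices `u` to be processed. The
procedure for the recursive calls is `gce`; the last argument collects the output. -/
noncomputable def gceLoop (L : LinkStream V) (t : ℝ) (R : List V)
    (gce : List V → List V → List V → List (Call V) → Timed (List (Call V))) :
    List V → List V → List V → List (Call V) → Timed (List (Call V))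
  | [], _, _, out => step out
  | u :: us, P, X, out =>
    (step (u :: R)).bind fun R' =>
    (Timed.filter (isNbr L t u) P).bind fun P' =>
    (Timed.filter (isNbr L t u) X).bind fun X' =>
    (gce R' P' X' out).bind fun out' =>
    (Timed.remove u P).bind fun P'' =>
    (step (u :: X)).bind fun X'' =>
    gceLoop L t R gce us P'' X'' out'

/-- The procedure `GCE(R, P, X, F, t)`, where `F` is the set of forbidden edges. The last argument
collects the output. The first argument bounds the depth of the recursion, only to make the
definition structurally recursive: `P` loses at least the vertex `u` with each level, hence the
bound `|P| + 1` is never reached. -/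
noncomputable def gce (t : ℝ) (F : Finset (Sym2 V)) :
    ℕ → List V → List V → List V → List (Call V) → Timed (List (Call V))
  | 0, _, _, _, out => step out
  | n + 1, R, P, X, out =>
    -- the output pair
    (Timed.append R []).bind fun C =>
    (Timed.append P X).bind fun N =>
    -- candidates which would add a forbidden edge to `R`
    (Timed.filter (fun u => Timed.any (fun v => step (decide (s(u, v) ∈ F))) R) P).bind fun Q =>
    -- candidates skipped thanks to the pivot, if pivoting is used
    (A.del t R P X).bind fun D =>
    (Timed.diff P D).bind fun P' =>
    (Timed.diff P' Q).bind fun cand =>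
    (step (⟨C, N, cand.isEmpty⟩ :: out)).bind fun out' =>
    gceLoop L t R (gce t F n) (A.order t R cand) P X out'

/-- The loop over the links that begin at time `t`; `F` is the set of forbidden edges. -/
noncomputable def linkLoop (t : ℝ) :
    List (Link V) → Finset (Sym2 V) → List (Call V) → Timed (List (Call V))
  | [], _, cliques => step cliques
  | l :: ls, F, cliques =>
    (step [l.u, l.v]).bind fun R =>
    (step (A.nbrs t l.u)).bind fun N =>
    (Timed.filter (isNbr L t l.v) N).bind fun P =>
    (A.gce t F (P.length + 1) R P [] cliques).bind fun cliques' =>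
    (step (insert s(l.u, l.v) F)).bind fun F' =>
    linkLoop t ls F' cliques'

/-- The enumeration phase at time `t`. Its result lists all calls of `GCE` made at time `t`, with
their outputs. -/
noncomputable def enumerate (t : ℝ) : Timed (List (Call V)) :=
  (step (A.starting t)).bind fun ls =>
  A.linkLoop t ls ∅ []

/-- The test phase at time `t`: among the enumerated pairs, output the cliques that are
vertex-maximal, with their time intervals. -/
noncomputable def testLoop (L : LinkStream V) (t : ℝ) :
    List (Call V) → List (List V × ℝ × WithTop ℝ) → Timed (List (List V × ℝ × WithTop ℝ))
  | [], out => step out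
  | c :: cs, out =>
    (cliqueEnd L t c.R).bind fun e =>
    (Timed.all (fun u =>
      (minEnd L t u c.R).bind fun m =>
      (step (min m e)).bind fun e' =>
      step (decide (e' < e))) c.N).bind fun ok =>
    (Timed.append c.R []).bind fun C =>
    (step (if ok then (C, t, e) :: out else out)).bind fun out' =>
    testLoop L t cs out'

/-- The loop over the instants. -/
noncomputable def timeLoop :
    List ℝ → List (List V × ℝ × WithTop ℝ) → Timed (List (List V × ℝ × WithTop ℝ))
  | [], out => step out
  | t :: ts, out =>
    (A.enumerate t).bind fun cliques =>
    (testLoop L t cliques out).bind fun out' =>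
    timeLoop ts out'

/-- The whole algorithm. -/
noncomputable def run : Timed (List (List V × ℝ × WithTop ℝ)) :=
  (step A.times).bind fun ts =>
  A.timeLoop ts []

/-- The leaves of the search forest of the recursive calls to `GCE` made by the algorithm, each
with the time at which the call is made. -/
noncomputable def leaves : List (ℝ × Call V) :=
  A.times.flatMap fun t => ((A.enumerate t).val.filter fun c => c.isLeaf).map fun c => (t, c)

/-- The call outputs a clique `C` of `G_t` such that `(C, [t, final time of C])` is a maximal
clique of the link stream. -/
def IsGood (L : LinkStream V) (x : ℝ × Call V) : Prop :=
  ∃ t₁ : ℝ, L.finalTime x.1 x.2.R.toFinset = t₁ ∧ L.IsMaximalClique x.2.R.toFinset x.1 t₁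

/-- The ratio `r` of the leaves that correspond to maximal cliques. -/
noncomputable def ratio : ℝ := by
  classical
  exact ((A.leaves.filter fun x => decide (IsGood L x)).length : ℝ) / (A.leaves.length : ℝ)

end Implementation

/-! Running time. At a fixed instant t, the calls of `GCE` visit pairwise distinct cliques of G_t,
each containing a link that begins at t. A clique and its common neighbourhood have size O(d), so a
call does O(d²) work of its own, pivot computation and later test included. Each recursive call adds
a vertex to a clique of size at least 2, so a branch of the forest contains fewer than q calls, and
there are at most q times as many calls as leaves. Hence the time is O(d² q · #leaves), and #leaves
is 1/r times the number of good leaves, which is at most α because good leaves yield distinct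
maximal cliques.

Ratio. Every vertex-maximal clique M of G_t containing a link that begins at t is found at a leaf,
with or without a pivot: a pivot allowing all of M \ R to be skipped would be adjacent to all of M.
Such a leaf is good, since the link beginning at t prevents extension to the past. Every leaf's
clique is contained in some such M, which has at most 2^q subsets, so #leaves ≤ 2^q · #good leaves.

The induction is carried by `gceLoop_spec`, `gce_spec` and `linkLoop_spec`; the counting by
`run_steps_le`, `length_leaves_le` and `length_goodLeaves_le`. -/

/-! ### Values and costs of the list primitives. -/

namespace Timed

variable {α β : Type*}

@[simp] theorem step_val (a : α) : (step a).val = a := rfl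
@[simp] theorem step_steps (a : α) : (step a).steps = 1 := rfl
@[simp] theorem bind_val (x : Timed α) (f : α → Timed β) : (x.bind f).val = (f x.val).val := rfl
@[simp] theorem bind_steps (x : Timed α) (f : α → Timed β) :
    (x.bind f).steps = x.steps + (f x.val).steps := rfl

@[simp] theorem filter_val (p : α → Timed Bool) (l : List α) :
    (filter p l).val = l.filter fun a => (p a).val := by
  induction l with
  | nil => rfl
  | cons a l ih => simp [filter, ih, List.filter_cons]

theorem filter_steps_le (p : α → Timed Bool) (k : ℕ) (hp : ∀ a, (p a).steps ≤ k) (l : List α) :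
    (filter p l).steps ≤ (k + 1) * l.length + 1 := by
  induction l with
  | nil => simp [filter]
  | cons a l ih =>
    have := hp a
    simp only [filter, bind_steps, step_steps, List.length_cons]
    linarith

@[simp] theorem map_val (f : α → Timed β) (l : List α) :
    (map f l).val = l.map fun a => (f a).val := by
  induction l with
  | nil => rfl
  | cons a l ih => simp [map, ih]

theorem map_steps_le (f : α → Timed β) (k : ℕ) (hf : ∀ a, (f a).steps ≤ k) (l : List α) :
    (map f l).steps ≤ (k + 1) * l.length + 1 := by
  induction l with
  | nil => simp [map]
  | cons a l ih =>
    have := hf a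
    simp only [map, bind_steps, step_steps, List.length_cons]
    linarith

@[simp] theorem any_val (p : α → Timed Bool) (l : List α) :
    (any p l).val = l.any fun a => (p a).val := by
  induction l with
  | nil => rfl
  | cons a l ih => simp [any, ih]

theorem any_steps_le (p : α → Timed Bool) (k : ℕ) (hp : ∀ a, (p a).steps ≤ k) (l : List α) :
    (any p l).steps ≤ (k + 1) * l.length + 1 := by
  induction l with
  | nil => simp [any]
  | cons a l ih =>
    have := hp a
    simp only [any, bind_steps, step_steps, List.length_cons]
    linarith

theorem all_steps_le (p : α → Timed Bool) (k : ℕ) (hp : ∀ a, (p a).steps ≤ k) (l : List α) :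
    (all p l).steps ≤ (k + 1) * l.length + 1 := by
  induction l with
  | nil => simp [all]
  | cons a l ih =>
    have := hp a
    simp only [all, bind_steps, step_steps, List.length_cons]
    linarith

@[simp] theorem append_val (l₁ l₂ : List α) : (append l₁ l₂).val = l₁ ++ l₂ := by
  induction l₁ with
  | nil => rfl
  | cons a l ih => simp [append, ih]

@[simp] theorem append_steps (l₁ l₂ : List α) : (append l₁ l₂).steps = l₁.length + 1 := by
  induction l₁ with
  | nil => rfl
  | cons a l ih => simp [append, ih]

@[simp] theorem diff_val [DecidableEq α] (l₁ l₂ : List α) :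
    (diff l₁ l₂).val = l₁.filter fun a => decide (a ∉ l₂) := by
  simp only [diff, filter_val, bind_val, any_val, step_val]
  congr 1
  funext a
  rw [Bool.eq_iff_iff]
  simp only [Bool.not_eq_true', List.any_eq_false, decide_eq_true_eq]
  exact ⟨fun h ha => h a ha rfl, fun h x hx hxa => h (hxa ▸ hx)⟩

theorem diff_steps_le [DecidableEq α] (l₁ l₂ : List α) :
    (diff l₁ l₂).steps ≤ (2 * l₂.length + 3) * l₁.length + 1 := by
  refine filter_steps_le _ _ (fun a => ?_) _
  have := any_steps_le (fun x => step (decide (x = a))) 1 (fun _ => le_rfl) l₂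
  simp only [bind_steps, step_steps]
  omega

@[simp] theorem remove_val [DecidableEq α] (a : α) (l : List α) :
    (remove a l).val = l.filter fun x => decide (x ≠ a) := by
  simp [remove]

theorem remove_steps_le [DecidableEq α] (a : α) (l : List α) :
    (remove a l).steps ≤ 2 * l.length + 1 :=
  filter_steps_le _ 1 (fun _ => le_rfl) _

end Timed

/-! ### Costs of final times and of pivot selection. -/

namespace LinkStream

variable {V : Type*} (L : LinkStream V)

theorem endTime_ne_top_iff {t : ℝ} {u v : V} :
    L.endTime t u v ≠ ⊤ ↔ (L.graphAt t).Adj u v := by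
  simp [endTime, graphAt, Finset.inf_eq_top_iff]

end LinkStream

namespace Implementation

open Timed

variable {V : Type*} {L : LinkStream V}

theorem minEnd_steps (t : ℝ) (u : V) (l : List V) :
    (minEnd L t u l).steps = 2 * l.length + 1 := by
  induction l with
  | nil => rfl
  | cons a l ih =>
    simp only [minEnd, bind_steps, step_steps, ih, List.length_cons]
    ring

theorem cliqueEnd_steps (t : ℝ) (l : List V) :
    (cliqueEnd L t l).steps = l.length ^ 2 + l.length + 1 := by
  induction l with
  | nil => rfl
  | cons a l ih =>
    simp only [cliqueEnd, bind_steps, step_steps, ih, minEnd_steps, List.length_cons]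
    ring

theorem extensionEnds_steps_le (t : ℝ) (R : List V) (eR : WithTop ℝ) (W : List V) :
    (extensionEnds L t R eR W).steps ≤ (2 * R.length + 4) * W.length + 1 := by
  refine map_steps_le _ _ (fun a => ?_) _
  simp only [bind_steps, step_steps, minEnd_steps]
  omega

theorem extensionEnds_val_map_fst (t : ℝ) (R : List V) (eR : WithTop ℝ) (W : List V) :
    (extensionEnds L t R eR W).val.map Prod.fst = W := by
  simp [extensionEnds, Function.comp_def]

theorem extensionEnds_val_length (t : ℝ) (R : List V) (eR : WithTop ℝ) (W : List V) :
    (extensionEnds L t R eR W).val.length = W.length := by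
  simp [extensionEnds]

theorem deletable_steps_le (t : ℝ) (P : List (V × WithTop ℝ)) (p : V × WithTop ℝ) :
    (deletable L t P p).steps ≤ 9 * P.length + 3 := by
  simp only [deletable, bind_steps, step_steps]
  refine (Nat.add_le_add (filter_steps_le _ 6 (fun _ => le_rfl) _)
    (Nat.add_le_add_right (map_steps_le _ 1 (fun _ => le_rfl) _) 1)).trans ?_
  rw [filter_val]
  have := List.length_filter_le (fun a => ((step (L.endTime t a.1 p.1)).bind fun e =>
    (step (decide (e ≠ ⊤))).bind fun b =>
    (step (min a.2 p.2)).bind fun e' =>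
    (step (min e' e)).bind fun e'' =>
    (step (decide (a.2 = e''))).bind fun b' =>
    step (b && b')).val) P
  omega

theorem deletable_val_length_le (t : ℝ) (P : List (V × WithTop ℝ)) (p : V × WithTop ℝ) :
    (deletable L t P p).val.2.length ≤ P.length := by
  simp only [deletable, bind_val, step_val, map_val, filter_val, List.length_map]
  exact List.length_filter_le _ _

theorem adj_of_mem_deletable {t : ℝ} {P : List (V × WithTop ℝ)} {p : V × WithTop ℝ} {u : V}
    (hu : u ∈ (deletable L t P p).val.2) : (L.graphAt t).Adj u p.1 := by
  simp only [deletable, bind_val, step_val, map_val, filter_val, List.mem_map,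
    List.mem_filter, Bool.and_eq_true] at hu
  obtain ⟨a, ⟨-, ha, -⟩, rfl⟩ := hu
  exact L.endTime_ne_top_iff.1 (of_decide_eq_true ha)

variable (A : Implementation L)

/-- The final times of R ∪ {u} are computed once per vertex, so each pair (pivot, candidate) costs
O(1) rather than O(|R|). This keeps the total quadratic in d. -/
theorem del_steps_le (t : ℝ) (R P X : List V) :
    (A.del t R P X).steps ≤ R.length ^ 2 + R.length +
      (2 * R.length + 9 * P.length + 11) * (P.length + X.length) + 7 := by
  unfold del
  split
  · simp
  · simp only [bind_steps, step_steps, cliqueEnd_steps, append_steps, append_val,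
      extensionEnds_val_length]
    set eR := (cliqueEnd L t R).val
    set P' := (extensionEnds L t R eR P).val with hP'
    set W := P' ++ (extensionEnds L t R eR X).val with hW
    have h1 := extensionEnds_steps_le (L := L) t R eR P
    have h2 := extensionEnds_steps_le (L := L) t R eR X
    have h3 := map_steps_le (deletable L t P') _ (deletable_steps_le t P') W
    have h4 := map_steps_le (step (α := V × List V)) 1 (fun _ => le_rfl)
      (map (deletable L t P') W).val
    have hPl : P'.length = P.length := extensionEnds_val_length ..
    have hWl : W.length = P.length + X.length := by
      rw [hW, List.length_append, hPl, extensionEnds_val_length]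
    rw [map_val, List.length_map, hWl] at h4
    rw [hWl, hPl] at h3
    rw [map_val]
    nlinarith

/-- All that completeness of the search needs from pivoting: the skipped vertices share a neighbour
p in P ∪ X. The empty case covers the algorithm without a pivot. -/
theorem del_eq_nil_or (t : ℝ) (R P X : List V) :
    (A.del t R P X).val = [] ∨ (A.del t R P X).val.length ≤ P.length ∧
      ∃ p, (p ∈ P ∨ p ∈ X) ∧ ∀ u ∈ (A.del t R P X).val, (L.graphAt t).Adj u p := by
  unfold del
  split
  · simp
  · rename_i rule hrule
    simp only [bind_val, step_val, map_val, append_val, List.map_id']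
    split_ifs with hc
    · exact .inl rfl
    · right
      have := A.pivot_mem rule hrule t R _ hc
      obtain ⟨w, hw, hwe⟩ := List.mem_map.1 this
      rw [← hwe]
      refine ⟨(deletable_val_length_le ..).trans_eq (extensionEnds_val_length ..), w.1, ?_,
        fun u hu => adj_of_mem_deletable hu⟩
      rw [List.mem_append] at hw
      refine hw.imp (fun h => ?_) (fun h => ?_)
      · simpa only [extensionEnds_val_map_fst] using List.mem_map_of_mem (f := Prod.fst) h
      · simpa only [extensionEnds_val_map_fst] using List.mem_map_of_mem (f := Prod.fst) h

end Implementation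

/-! ### Maximal cliques of G_t and of the link stream. -/

namespace LinkStream

variable {V : Type*} (L : LinkStream V)

/-- No vertex is adjacent in `G_t` to all vertices of the clique `M` of `G_t`. -/
structure IsMaximalAt (t : ℝ) (M : Finset V) : Prop where
  adj : ∀ u ∈ M, ∀ v ∈ M, u ≠ v → (L.graphAt t).Adj u v
  not_adj : ∀ p, ¬ ∀ u ∈ M, (L.graphAt t).Adj u p

section vertices

open Classical in
/-- The end points of the links. -/
noncomputable def vertices : Finset V := L.E.image Link.u ∪ L.E.image Link.v

variable {L}

theorem mem_vertices_of_joins {l : Link V} (hl : l ∈ L.E) {u v : V} (h : l.Joins u v) :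
    u ∈ L.vertices := by
  classical
  simp only [vertices, Finset.mem_union, Finset.mem_image]
  rcases h with ⟨h, -⟩ | ⟨-, h⟩
  · exact .inl ⟨l, hl, h⟩
  · exact .inr ⟨l, hl, h⟩

theorem mem_vertices_of_adj {t : ℝ} {u v : V} (h : (L.graphAt t).Adj u v) : u ∈ L.vertices :=
  let ⟨_, hl, hj, _⟩ := h
  mem_vertices_of_joins hl hj

theorem IsClique.subset_vertices {C : Finset V} {t₀ t₁ : ℝ} (h : L.IsClique C t₀ t₁) :
    C ⊆ L.vertices := fun u hu => by
  obtain ⟨v, hv, hvu⟩ := Finset.exists_mem_ne h.1 u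
  obtain ⟨l, hl, hj, -⟩ := h.2.2.2.2 u hu v hv hvu.symm
  exact mem_vertices_of_joins hl hj

theorem mem_Icc_of_adj {t : ℝ} {u v : V} (h : (L.graphAt t).Adj u v) :
    t ∈ Set.Icc L.start L.finish :=
  let ⟨_, hl, _, ht⟩ := h
  ⟨(L.start_le _ hl).trans ht.1, ht.2.trans (L.le_finish _ hl)⟩

/-- `V` may be infinite, but all neighbourhoods lie in the finite set `vertices`, so the supremum
defining `maxDegree` is over a bounded set. The empty list is treated apart because t may then lie
outside the time interval. -/
theorem length_le_maxDegree {t : ℝ} {u : V} {l : List V} (hl : l.Nodup)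
    (h : ∀ w ∈ l, (L.graphAt t).Adj u w) : l.length ≤ L.maxDegree := by
  classical
  cases l with
  | nil => simp
  | cons w l =>
    have key : ∀ (t : ℝ) (u : V), (L.graphAt t).neighborSet u ⊆ L.vertices :=
      fun t u w hw => mem_vertices_of_adj hw.symm
    have hb : BddAbove {k : ℕ | ∃ t ∈ Set.Icc L.start L.finish, ∃ u : V,
        ((L.graphAt t).neighborSet u).ncard = k} := by
      refine ⟨L.vertices.card, ?_⟩
      rintro _ ⟨t, -, u, rfl⟩
      rw [← Set.ncard_coe_finset]
      exact Set.ncard_le_ncard (key t u) (Finset.finite_toSet _)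
    refine le_trans ?_ (le_csSup hb ⟨t, mem_Icc_of_adj (h w (by simp)), u, rfl⟩)
    rw [← List.toFinset_card_of_nodup hl, ← Set.ncard_coe_finset]
    exact Set.ncard_le_ncard (fun x hx => h x (by simpa using hx))
      ((Finset.finite_toSet _).subset (key t u))

theorem IsClique.card_le {C : Finset V} {t₀ t₁ : ℝ} (h : L.IsClique C t₀ t₁) :
    C.card ≤ L.maxCliqueSize := by
  refine le_csSup ⟨L.vertices.card, ?_⟩ ⟨C, t₀, t₁, h, rfl⟩
  rintro _ ⟨C, t₀, t₁, h, rfl⟩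
  exact Finset.card_le_card h.subset_vertices

theorem isClique_of_adj {t : ℝ} {C : Finset V} (hC : 2 ≤ C.card)
    (h : ∀ u ∈ C, ∀ v ∈ C, u ≠ v → (L.graphAt t).Adj u v) : L.IsClique C t t := by
  obtain ⟨u, hu, v, hv, huv⟩ := Finset.one_lt_card.1 hC
  have ht := mem_Icc_of_adj (h u hu v hv huv)
  refine ⟨hC, ht.1, le_rfl, ht.2, fun u hu v hv huv => ?_⟩
  obtain ⟨l, hl, hj, ht⟩ := h u hu v hv huv
  exact ⟨l, hl, hj, by simpa using ht⟩

theorem IsClique.adj {C : Finset V} {t₀ t₁ t : ℝ} (h : L.IsClique C t₀ t₁)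
    (ht : t ∈ Set.Icc t₀ t₁) {u v : V} (hu : u ∈ C) (hv : v ∈ C) (huv : u ≠ v) :
    (L.graphAt t).Adj u v :=
  let ⟨l, hl, hj, hi⟩ := h.2.2.2.2 u hu v hv huv
  ⟨l, hl, hj, hi ht⟩

end vertices

variable {L}

theorem eq_of_joins {l l' : Link V} (hl : l ∈ L.E) (hl' : l' ∈ L.E) {u v : V}
    (h : l.Joins u v) (h' : l'.Joins u v) {t : ℝ} (ht : t ∈ l.interval) (ht' : t ∈ l'.interval) :
    l = l' := by
  by_contra hne
  refine Set.disjoint_left.1 (L.simple l hl l' hl' hne ?_) ht ht'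
  rcases h with ⟨rfl, rfl⟩ | ⟨rfl, rfl⟩
  · exact h'
  · exact Or.symm h'

theorem coe_le_endTime_iff {t t₁ : ℝ} {u v : V} :
    (t₁ : WithTop ℝ) ≤ L.endTime t u v ↔
      ∀ l ∈ L.E, l.Joins u v → t ∈ l.interval → t₁ ≤ l.e := by
  simp only [endTime, Finset.le_inf_iff, Finset.mem_filter, WithTop.coe_le_coe, and_imp]

theorem coe_le_finalTime_iff {t t₁ : ℝ} {C : Finset V} :
    (t₁ : WithTop ℝ) ≤ L.finalTime t C ↔
      ∀ u ∈ C, ∀ v ∈ C, ∀ l ∈ L.E, l.Joins u v → t ∈ l.interval → t₁ ≤ l.e := by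
  simp only [finalTime, Finset.le_inf_iff, coe_le_endTime_iff]

theorem IsClique.le_finalTime {t₀ t₁ t : ℝ} {C : Finset V} (h : L.IsClique C t₀ t₁)
    (ht : t ∈ Set.Icc t₀ t₁) : (t₁ : WithTop ℝ) ≤ L.finalTime t C := by
  refine coe_le_finalTime_iff.2 fun u hu v hv l hl hj htl => ?_
  have huv : u ≠ v := by
    rintro rfl
    exact L.loopless l hl (hj.elim (fun h => h.1.trans h.2.symm) (fun h => h.1.trans h.2.symm))
  obtain ⟨l', hl', hj', hi⟩ := h.2.2.2.2 u hu v hv huv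
  rw [eq_of_joins hl hl' hj hj' htl (hi ht)]
  exact (hi ⟨h.2.2.1, le_rfl⟩).2

/-- By simplicity, l is the only link on its pair present at l.b, so no clique interval for M around
l.b starts earlier. None ends after the final time of M, and a further vertex would be adjacent to
all of M at l.b. -/
theorem IsMaximalAt.isMaximalClique {M : Finset V} {l : Link V} (hM : L.IsMaximalAt l.b M)
    (hl : l ∈ L.E) (hu : l.u ∈ M) (hv : l.v ∈ M) :
    ∃ t₁ : ℝ, L.finalTime l.b M = t₁ ∧ L.IsMaximalClique M l.b t₁ := by
  have hlb : l.b ∈ l.interval := ⟨le_rfl, L.b_le_e l hl⟩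
  have hlj : l.Joins l.u l.v := .inl ⟨rfl, rfl⟩
  have hne := L.loopless l hl
  have htop : L.finalTime l.b M ≠ ⊤ := by
    refine ne_top_of_le_ne_top (L.endTime_ne_top_iff.2 ⟨l, hl, hlj, hlb⟩) ?_
    exact (Finset.inf_le hu).trans (Finset.inf_le hv)
  obtain ⟨t₁, ht₁⟩ := WithTop.ne_top_iff_exists.1 htop
  have hle := coe_le_finalTime_iff.1 ht₁.le
  have hcl0 : L.IsClique M l.b l.b :=
    isClique_of_adj (Finset.one_lt_card.2 ⟨_, hu, _, hv, hne⟩) hM.adj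
  have hbt : l.b ≤ t₁ := by
    rw [← WithTop.coe_le_coe, ht₁]
    exact hcl0.le_finalTime (by simp)
  have hcl : L.IsClique M l.b t₁ := by
    refine ⟨hcl0.1, hcl0.2.1, hbt,
      (hle _ hu _ hv l hl hlj hlb).trans (L.le_finish l hl), fun u hu v hv huv => ?_⟩
    obtain ⟨l', hl', hj', ht'⟩ := hM.adj u hu v hv huv
    exact ⟨l', hl', hj', Set.Icc_subset_Icc ht'.1 (hle u hu v hv l' hl' hj' ht')⟩
  refine ⟨t₁, ht₁.symm, ⟨hcl, ?_⟩, hcl, ?_⟩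
  · rintro ⟨t₀', t₁', h', hss⟩
    refine hss.2 (Set.Icc_subset_Icc ?_ ?_)
    · obtain ⟨l', hl', hj', hi⟩ := h'.2.2.2.2 _ hu _ hv hne
      rw [eq_of_joins hl hl' hlj hj' hlb (hi (hss.1 ⟨le_rfl, hbt⟩))]
      exact (hi ⟨le_rfl, h'.2.2.1⟩).1
    · rw [← WithTop.coe_le_coe, ht₁]
      exact h'.le_finalTime (hss.1 ⟨le_rfl, hbt⟩)
  · rintro ⟨C', h', hss⟩
    obtain ⟨p, hp, hpM⟩ := Finset.exists_of_ssubset hss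
    exact hM.not_adj p fun u hu =>
      h'.adj ⟨le_rfl, hbt⟩ (hss.1 hu) hp (ne_of_mem_of_not_mem hu hpM)

/-- Cliques with at least two vertices lie in the finite set `vertices`, so an inclusion-maximal one
exists above C. -/
theorem exists_isMaximalAt {t : ℝ} {C : Finset V} (hC : 2 ≤ C.card)
    (h : ∀ u ∈ C, ∀ v ∈ C, u ≠ v → (L.graphAt t).Adj u v) :
    ∃ M, C ⊆ M ∧ L.IsMaximalAt t M := by
  classical
  have hfin : {M : Finset V | 2 ≤ M.card ∧ ∀ u ∈ M, ∀ v ∈ M, u ≠ v →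
      (L.graphAt t).Adj u v}.Finite :=
    (Finset.finite_toSet L.vertices.powerset).subset fun M hM => by
      simpa using (isClique_of_adj hM.1 hM.2).subset_vertices
  obtain ⟨M, hCM, hM⟩ := hfin.exists_le_maximal ⟨hC, h⟩
  refine ⟨M, hCM, hM.prop.2, fun p hp => ?_⟩
  have hpM : p ∉ M := fun hpM => (hp p hpM).ne rfl
  have hins : insert p M ⊆ M := by
    refine hM.le_of_ge ⟨hM.prop.1.trans (Finset.card_le_card (Finset.subset_insert _ _)), ?_⟩
      (Finset.subset_insert _ _)
    intro u hu v hv huv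
    rcases Finset.mem_insert.1 hu with hup | huM <;> rcases Finset.mem_insert.1 hv with hvp | hvM
    · exact absurd (hup.trans hvp.symm) huv
    · exact hup ▸ (hp v hvM).symm
    · exact hvp ▸ hp u huM
    · exact hM.prop.2 u huM v hvM huv
  exact hpM (hins (Finset.mem_insert_self _ _))

theorem IsClique.hull {C : Finset V} {s₀ s₁ t₀ t₁ : ℝ} (hs : L.IsClique C s₀ s₁)
    (ht : L.IsClique C t₀ t₁) (h : ∀ l ∈ L.E, Set.Icc s₀ s₁ ⊆ l.interval →
      Set.Icc t₀ t₁ ⊆ l.interval) : L.IsClique C (min s₀ t₀) (max s₁ t₁) := by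
  refine ⟨hs.1, le_min hs.2.1 ht.2.1, (min_le_left _ _).trans (hs.2.2.1.trans (le_max_left _ _)),
    max_le hs.2.2.2.1 ht.2.2.2.1, fun u hu v hv huv => ?_⟩
  obtain ⟨l, hl, hj, hi⟩ := hs.2.2.2.2 u hu v hv huv
  have hi' := h l hl hi
  exact ⟨l, hl, hj, Set.Icc_subset_Icc
    (le_min (hi ⟨le_rfl, hs.2.2.1⟩).1 (hi' ⟨le_rfl, ht.2.2.1⟩).1)
    (max_le (hi ⟨hs.2.2.1, le_rfl⟩).2 (hi' ⟨ht.2.2.1, le_rfl⟩).2)⟩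

theorem IsTimeMaximal.eq_of_le {C : Finset V} {s₀ s₁ t₀ t₁ : ℝ} (hs : L.IsTimeMaximal C s₀ s₁)
    (ht : L.IsClique C t₀ t₁) (h₀ : t₀ ≤ s₀) (h₁ : s₁ ≤ t₁) : t₀ = s₀ ∧ t₁ = s₁ := by
  have hsub : Set.Icc t₀ t₁ ⊆ Set.Icc s₀ s₁ := by
    by_contra hn
    exact hs.2 ⟨t₀, t₁, ht, Set.Icc_subset_Icc h₀ h₁, hn⟩
  exact ⟨le_antisymm h₀ (hsub ⟨le_rfl, ht.2.2.1⟩).1, le_antisymm (hsub ⟨ht.2.2.1, le_rfl⟩).2 h₁⟩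

variable (L) in
-- A maximal clique is determined by its vertices and the set of links whose intervals contain its
-- own: if two agree in both, the hull of their intervals also gives a clique, so time-maximality
-- makes both equal to it. Finiteness is what makes the `ncard` defining α a genuine count.
theorem finite_isMaximalClique :
    {x : Finset V × ℝ × ℝ | L.IsMaximalClique x.1 x.2.1 x.2.2}.Finite := by
  classical
  refine Set.Finite.of_finite_image (f := fun x : Finset V × ℝ × ℝ =>
    (x.1, L.E.filter fun l => Set.Icc x.2.1 x.2.2 ⊆ l.interval)) ?_ ?_
  · refine (Finset.finite_toSet (L.vertices.powerset ×ˢ L.E.powerset)).subset ?_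
    rintro _ ⟨x, hx, rfl⟩
    simpa using ⟨IsClique.subset_vertices hx.1.1, fun l hl => hl.1⟩
  · rintro ⟨C, s₀, s₁⟩ hs ⟨C', t₀, t₁⟩ ht hst
    simp only [Prod.mk.injEq] at hst
    obtain ⟨rfl, hst⟩ := hst
    have h : ∀ l ∈ L.E, Set.Icc s₀ s₁ ⊆ l.interval → Set.Icc t₀ t₁ ⊆ l.interval := by
      intro l hl hi
      have : l ∈ L.E.filter fun l => Set.Icc s₀ s₁ ⊆ l.interval := Finset.mem_filter.2 ⟨hl, hi⟩
      rw [hst] at this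
      exact (Finset.mem_filter.1 this).2
    have hH := IsClique.hull hs.1.1 ht.1.1 h
    obtain ⟨h1, h2⟩ := IsTimeMaximal.eq_of_le hs.1 hH (min_le_left _ _) (le_max_left _ _)
    obtain ⟨h3, h4⟩ := IsTimeMaximal.eq_of_le ht.1 hH (min_le_right _ _) (le_max_right _ _)
    simp only [Prod.mk.injEq, true_and]
    exact ⟨h1.symm.trans h3, h2.symm.trans h4⟩

end LinkStream

/-! ### Invariants of the recursive search. -/

namespace Implementation

open Timed

variable {V : Type*} {L : LinkStream V}

/-- The list of vertices is a clique of `G_t` without edges in `F`. -/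
def IsFreeClique (L : LinkStream V) (t : ℝ) (F : Finset (Sym2 V)) (R : List V) : Prop :=
  R.Pairwise fun u v => (L.graphAt t).Adj u v ∧ s(u, v) ∉ F

theorem IsFreeClique.mono {t : ℝ} {F F' : Finset (Sym2 V)} {R : List V}
    (h : IsFreeClique L t F' R) (hF : F ⊆ F') : IsFreeClique L t F R :=
  h.imp fun h => ⟨h.1, fun hm => h.2 (hF hm)⟩

theorem IsFreeClique.nodup {t : ℝ} {F : Finset (Sym2 V)} {R : List V}
    (h : IsFreeClique L t F R) : R.Nodup :=
  h.imp fun h => h.1.ne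

theorem IsFreeClique.adj {t : ℝ} {F : Finset (Sym2 V)} {R : List V}
    (h : IsFreeClique L t F R) {u v : V} (hu : u ∈ R) (hv : v ∈ R) (huv : u ≠ v) :
    (L.graphAt t).Adj u v ∧ s(u, v) ∉ F :=
  haveI : Std.Symm fun u v => (L.graphAt t).Adj u v ∧ s(u, v) ∉ F :=
    ⟨fun _ _ h => ⟨h.1.symm, Sym2.eq_swap ▸ h.2⟩⟩
  List.Pairwise.forall h hu hv huv

theorem IsFreeClique.length_le_maxDegree {t : ℝ} {F : Finset (Sym2 V)} {R : List V}
    (h : IsFreeClique L t F R) : R.length ≤ L.maxDegree + 1 := by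
  cases R with
  | nil => simp
  | cons u R =>
    have h' := List.pairwise_cons.1 h
    exact Nat.succ_le_succ (LinkStream.length_le_maxDegree (List.nodup_cons.1 h.nodup).2
      fun w hw => (h'.1 w hw).1)

theorem IsFreeClique.length_le_maxCliqueSize [DecidableEq V] {t : ℝ} {F : Finset (Sym2 V)}
    {R : List V} (h : IsFreeClique L t F R) (h2 : 2 ≤ R.length) :
    R.length ≤ L.maxCliqueSize := by
  rw [← List.toFinset_card_of_nodup h.nodup] at h2 ⊢
  exact (LinkStream.isClique_of_adj h2 fun u hu v hv huv =>
    (h.adj (List.mem_toFinset.1 hu) (List.mem_toFinset.1 hv) huv).1).card_le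

/-- A call outputs a clique without edges in `F`, and vertices adjacent to this clique. -/
structure IsValid (L : LinkStream V) (t : ℝ) (F : Finset (Sym2 V)) (c : Call V) : Prop where
  two_le : 2 ≤ c.R.length
  free : IsFreeClique L t F c.R
  length_le : c.N.length ≤ L.maxDegree

/-- The sets between `R` and `R ∪ P`. -/
def Between (R P : List V) (C : Finset V) : Prop :=
  (∀ u ∈ R, u ∈ C) ∧ ∀ u ∈ C, u ∈ R ∨ u ∈ P

/-- No two vertices of the set are joined by an edge in `F`. -/
def Avoids (F : Finset (Sym2 V)) (C : Finset V) : Prop :=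
  ∀ u ∈ C, ∀ v ∈ C, u ≠ v → s(u, v) ∉ F

/-- The calls visit pairwise distinct cliques that satisfy `T` and avoid `F`, among them, as
leaves, all maximal ones; there are at most `k` times as many calls as leaves. -/
structure IsSearch [DecidableEq V] (L : LinkStream V) (t : ℝ) (F : Finset (Sym2 V))
    (T : Finset V → Prop) (k : ℕ) (cs : List (Call V)) : Prop where
  valid : ∀ c ∈ cs, IsValid L t F c
  target : ∀ c ∈ cs, T c.R.toFinset
  nodup : (cs.map fun c => c.R.toFinset).Nodup
  length_le : cs.length ≤ k * cs.countP Call.isLeaf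
  cover : ∀ M, L.IsMaximalAt t M → Avoids F M → T M →
    ∃ c ∈ cs, c.isLeaf = true ∧ c.R.toFinset = M

/-- What holds for the arguments of every call of `GCE`. -/
structure IsState (L : LinkStream V) (t : ℝ) (F : Finset (Sym2 V)) (R P X : List V) : Prop where
  two_le : 2 ≤ R.length
  free : IsFreeClique L t F R
  nodup : (P ++ X).Nodup
  adj : ∀ w, w ∈ P ∨ w ∈ X → ∀ u ∈ R, (L.graphAt t).Adj w u

theorem mem_filter_isNbr {t : ℝ} {u w : V} {P : List V} :
    w ∈ (Timed.filter (isNbr L t u) P).val ↔ w ∈ P ∧ (L.graphAt t).Adj u w := by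
  simp only [filter_val, List.mem_filter, isNbr, step_val]
  exact and_congr_right fun _ => decide_eq_true_iff.trans L.endTime_ne_top_iff

theorem IsState.one_le_maxDegree {t : ℝ} {F : Finset (Sym2 V)} {R P X : List V}
    (h : IsState L t F R P X) : 1 ≤ L.maxDegree := by
  have := h.free.length_le_maxDegree
  have := h.two_le
  omega

theorem IsState.length_add_le {t : ℝ} {F : Finset (Sym2 V)} {R P X : List V}
    (h : IsState L t F R P X) : P.length + X.length ≤ L.maxDegree := by
  obtain ⟨u, hu⟩ := List.exists_mem_of_length_pos (by have := h.two_le; omega : 0 < R.length)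
  rw [← List.length_append]
  exact LinkStream.length_le_maxDegree (u := u) h.nodup
    fun w hw => (h.adj w (List.mem_append.1 hw) u hu).symm

theorem IsState.notMem {t : ℝ} {F : Finset (Sym2 V)} {R P X : List V}
    (h : IsState L t F R P X) {w : V} (hw : w ∈ P ∨ w ∈ X) : w ∉ R :=
  fun hR => (h.adj w hw w hR).ne rfl

theorem IsState.child {t : ℝ} {F : Finset (Sym2 V)} {R P X : List V}
    (h : IsState L t F R P X) {u : V} (hu : u ∈ P) (hF : ∀ v ∈ R, s(u, v) ∉ F) :
    IsState L t F (u :: R) (Timed.filter (isNbr L t u) P).val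
      (Timed.filter (isNbr L t u) X).val where
  two_le := h.two_le.trans (Nat.le_succ _)
  free := List.pairwise_cons.2 ⟨fun v hv => ⟨h.adj u (.inl hu) v hv, hF v hv⟩, h.free⟩
  nodup := by
    rw [filter_val, filter_val, ← List.filter_append]
    exact h.nodup.filter _
  adj w hw v hv := by
    simp only [mem_filter_isNbr] at hw
    rcases List.mem_cons.1 hv with rfl | hv
    · exact (hw.elim And.right And.right).symm
    · exact h.adj w (hw.imp And.left And.left) v hv

theorem length_filter_isNbr_lt {t : ℝ} {u : V} {P : List V} (hu : u ∈ P) :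
    (Timed.filter (isNbr L t u) P).val.length < P.length := by
  rw [filter_val]
  refine List.length_filter_lt_length_iff_exists.2 ⟨u, hu, fun h => ?_⟩
  have : u ∈ (Timed.filter (isNbr L t u) P).val := by
    rw [filter_val]
    exact List.mem_filter.2 ⟨hu, h⟩
  exact (mem_filter_isNbr.1 this).2.ne rfl

variable [DecidableEq V]

/-- Glues consecutive parts of the search. The property T₁ separates them: no clique of the later
part b has it, and each maximal target clique either has it or is still a target of b under the
larger set F'. -/
theorem IsSearch.append {t : ℝ} {F F' : Finset (Sym2 V)} {T T₁ T₂ : Finset V → Prop} {k : ℕ}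
    {a b : List (Call V)} (ha : IsSearch L t F T₁ k a) (hb : IsSearch L t F' T₂ k b)
    (hF : F ⊆ F') (h₁ : ∀ c ∈ a, T₁ c.R.toFinset → T c.R.toFinset)
    (h₂ : ∀ c ∈ b, T₂ c.R.toFinset → T c.R.toFinset)
    (hd : ∀ c ∈ b, ¬ T₁ c.R.toFinset)
    (hc : ∀ M, L.IsMaximalAt t M → Avoids F M → T M → T₁ M ∨ (T₂ M ∧ Avoids F' M)) :
    IsSearch L t F T k (b ++ a) where
  valid c hm := (List.mem_append.1 hm).elim
    (fun h => ⟨(hb.valid c h).two_le, (hb.valid c h).free.mono hF, (hb.valid c h).length_le⟩)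
    (ha.valid c)
  target c hm := (List.mem_append.1 hm).elim (fun h => h₂ c h (hb.target c h))
    (fun h => h₁ c h (ha.target c h))
  nodup := by
    rw [List.map_append, List.nodup_append']
    refine ⟨hb.nodup, ha.nodup, fun C hC hC' => ?_⟩
    obtain ⟨c, hcb, rfl⟩ := List.mem_map.1 hC
    obtain ⟨c', hca, he⟩ := List.mem_map.1 hC'
    exact hd c hcb (he ▸ ha.target c' hca)
  length_le := by
    rw [List.length_append, List.countP_append, mul_add]
    exact Nat.add_le_add hb.length_le ha.length_le
  cover M hM hA hT := by
    rcases hc M hM hA hT with h | ⟨h, hA'⟩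
    · obtain ⟨c, hca, h⟩ := ha.cover M hM hA h
      exact ⟨c, List.mem_append_right _ hca, h⟩
    · obtain ⟨c, hcb, h⟩ := hb.cover M hM hA' h
      exact ⟨c, List.mem_append_left _ hcb, h⟩

theorem IsState.next {t : ℝ} {F : Finset (Sym2 V)} {R P X : List V}
    (h : IsState L t F R P X) {u : V} (hu : u ∈ P) :
    IsState L t F R (Timed.remove u P).val (u :: X) where
  two_le := h.two_le
  free := h.free
  nodup := by
    obtain ⟨hP, hX, hPX⟩ := List.nodup_append'.1 h.nodup
    refine List.nodup_append'.2 ⟨?_, List.nodup_cons.2 ⟨fun hX => hPX hu hX, hX⟩, ?_⟩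
    · rw [remove_val]
      exact hP.filter _
    · intro w hw hw'
      simp only [remove_val, List.mem_filter, decide_eq_true_eq] at hw
      exact (List.mem_cons.1 hw').elim hw.2 (fun h => hPX hw.1 h)
  adj w hw v hv := by
    simp only [remove_val, List.mem_filter, List.mem_cons] at hw
    refine h.adj w ?_ v hv
    rcases hw with hw | rfl | hw
    exacts [.inl hw.1, .inl hu, .inr hw]

/-- What holds for the result of a call `GCE(R, P, X, …)`: the new calls, with the running time
charged to them. -/
def GceSpec (L : LinkStream V) (t : ℝ) (F : Finset (Sym2 V)) (R P : List V)
    (out : List (Call V)) (res : Timed (List (Call V))) : Prop :=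
  ∃ new, res.val = new ++ out ∧
    res.steps + 9 * L.maxDegree ^ 2 ≤ 100 * L.maxDegree ^ 2 * new.length ∧
    IsSearch L t F (Between R P) (L.maxCliqueSize + 1 - R.length) new

/-- The targets split by the first loop vertex they contain: those with u belong to its recursive
call, the others survive the removal of u from P. -/
theorem gceLoop_spec {t : ℝ} {F : Finset (Sym2 V)} {R : List V} {n : ℕ}
    {g : List V → List V → List V → List (Call V) → Timed (List (Call V))}
    (hg : ∀ R' P' X' out, IsState L t F R' P' X' → P'.length < n →
      GceSpec L t F R' P' out (g R' P' X' out))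
    (us P X : List V) (out : List (Call V)) (h : IsState L t F R P X) (hn : P.length ≤ n)
    (hus : us.Nodup) (husP : ∀ u ∈ us, u ∈ P) (husF : ∀ u ∈ us, ∀ v ∈ R, s(u, v) ∉ F) :
    ∃ new, (gceLoop L t R g us P X out).val = new ++ out ∧
      (gceLoop L t R g us P X out).steps ≤ 100 * L.maxDegree ^ 2 * new.length + 1 ∧
      IsSearch L t F (fun C => Between R P C ∧ ∃ u ∈ us, u ∈ C)
        (L.maxCliqueSize - R.length) new ∧ (us ≠ [] → new ≠ []) := by
  induction us generalizing P X out with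
  | nil => exact ⟨[], rfl, le_rfl, ⟨by simp, by simp, by simp, by simp, by simp⟩, by simp⟩
  | cons u us ih =>
    have huP := husP u (by simp)
    obtain ⟨hu, hus⟩ := List.nodup_cons.1 hus
    have hch := h.child huP (husF u (by simp))
    obtain ⟨a, hav, has, ha⟩ := hg _ _ _ out hch ((length_filter_isNbr_lt huP).trans_le hn)
    obtain ⟨b, hbv, hbs, hb, -⟩ := ih (Timed.remove u P).val (u :: X) (a ++ out) (h.next huP)
      ((by rw [remove_val]; exact List.length_filter_le _ _ :
        (Timed.remove u P).val.length ≤ P.length).trans hn) hus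
      (fun w hw => by
        rw [remove_val]
        exact List.mem_filter.2 ⟨husP w (by simp [hw]),
          decide_eq_true (ne_of_mem_of_not_mem hw hu)⟩)
      (fun w hw => husF w (by simp [hw]))
    refine ⟨b ++ a, ?_, ?_, ?_, fun _ hab => ?_⟩
    · simp only [gceLoop, bind_val, step_val]
      rw [hav, hbv, List.append_assoc]
    · simp only [gceLoop, bind_steps, step_val, step_steps]
      rw [hav]
      have h1 := filter_steps_le (isNbr L t u) 1 (fun _ => le_rfl) P
      have h2 := filter_steps_le (isNbr L t u) 1 (fun _ => le_rfl) X
      have h3 := remove_steps_le u P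
      have h4 := h.length_add_le
      have h5 := h.one_le_maxDegree
      rw [List.length_append]
      -- This iteration costs 4|P| + 2|X| + 5 ≤ 9d² outside the recursive call, exactly the reserve
      -- kept in `GceSpec`.
      nlinarith
    -- The child's factor q + 1 - (|R| + 1) equals the loop's factor q - |R|.
    · rw [List.length_cons, Nat.add_sub_add_right] at ha
      refine ha.append hb subset_rfl ?_ ?_ ?_ ?_
      · rintro c - ⟨h1, h2⟩
        refine ⟨⟨fun w hw => h1 w (by simp [hw]), fun w hw => ?_⟩, u, by simp, h1 u (by simp)⟩
        rcases h2 w hw with hw | hw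
        · rcases List.mem_cons.1 hw with rfl | hw
          exacts [.inr huP, .inl hw]
        · exact .inr (mem_filter_isNbr.1 hw).1
      · rintro c - ⟨⟨h1, h2⟩, w, hw, hwc⟩
        refine ⟨⟨h1, fun w hw => (h2 w hw).imp_right fun hw => ?_⟩, w, by simp [hw], hwc⟩
        rw [remove_val] at hw
        exact (List.mem_filter.1 hw).1
      -- Later cliques lie in R ∪ (P \ {u}), hence miss u.
      · rintro c hc ⟨h1, -⟩
        rcases (hb.target c hc).1.2 u (h1 u (by simp)) with hw | hw
        · exact h.notMem (.inl huP) hw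
        · rw [remove_val] at hw
          simpa using (List.mem_filter.1 hw).2
      · rintro M hM hA ⟨⟨h1, h2⟩, w, hw, hwM⟩
        by_cases huM : u ∈ M
        · refine .inl ⟨fun v hv => ?_, fun v hv => ?_⟩
          · rcases List.mem_cons.1 hv with rfl | hv
            exacts [huM, h1 v hv]
          · by_cases hvu : v = u
            · exact .inl (by simp [hvu])
            · exact (h2 v hv).imp (by simp +contextual)
                fun hvP => mem_filter_isNbr.2 ⟨hvP, hM.adj u huM v hv (Ne.symm hvu)⟩
        · refine .inr ⟨⟨⟨h1, fun v hv => (h2 v hv).imp_right fun hvP => ?_⟩, w, ?_, hwM⟩, hA⟩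
          · rw [remove_val]
            exact List.mem_filter.2 ⟨hvP, decide_eq_true (ne_of_mem_of_not_mem hv huM)⟩
          · exact (List.mem_cons.1 hw).resolve_left (ne_of_mem_of_not_mem hwM huM)
    · have := h.one_le_maxDegree
      -- A recursive call making no calls would leave nothing to pay for the reserve 9d² > 0.
      rw [(List.append_eq_nil_iff.1 hab).2, List.length_nil] at has
      nlinarith

variable (A : Implementation L)

/-- Induction on the depth bound: the call adds itself to the calls of its loop. A maximal target M
is either R itself, and then the call is a leaf, or has a vertex outside R that the loop processes.
-/
theorem gce_spec (t : ℝ) (F : Finset (Sym2 V)) (n : ℕ) (R P X : List V) (out : List (Call V))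
    (h : IsState L t F R P X) (hn : P.length < n) :
    GceSpec L t F R P out (A.gce t F n R P X out) := by
  induction n generalizing R P X out with
  | zero => omega
  | succ n ih =>
    set Qt := Timed.filter (fun u => Timed.any (fun v => step (decide (s(u, v) ∈ F))) R) P with hQt
    set D := (A.del t R P X).val with hD
    set P' := (Timed.diff P D).val with hP'
    set cand := (Timed.diff P' Qt.val).val with hcand
    have hQ : ∀ u, u ∈ Qt.val ↔ u ∈ P ∧ ∃ v ∈ R, s(u, v) ∈ F := fun u => by
      simp [hQt]
    have hcandm : ∀ u, u ∈ cand ↔ u ∈ P ∧ u ∉ D ∧ ∀ v ∈ R, s(u, v) ∉ F := fun u => by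
      simp only [hcand, hP', diff_val, List.mem_filter, decide_eq_true_eq, hQ]
      constructor
      · rintro ⟨⟨h1, h2⟩, h3⟩
        exact ⟨h1, h2, fun v hv hF => h3 ⟨h1, v, hv, hF⟩⟩
      · rintro ⟨h1, h2, h3⟩
        exact ⟨⟨h1, h2⟩, fun ⟨_, v, hv, hF⟩ => h3 v hv hF⟩
    have hperm := A.order_perm t R cand
    have hPn := (List.nodup_append'.1 h.nodup).1
    have hcn : cand.Nodup := by
      rw [hcand, hP', diff_val, diff_val]
      exact (hPn.filter _).filter _
    obtain ⟨new, hv, hs, hS, hnew⟩ := gceLoop_spec (fun R' P' X' out h h' => ih R' P' X' out h h')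
      (A.order t R cand) P X (⟨R, P ++ X, cand.isEmpty⟩ :: out) h (Nat.le_of_lt_succ hn)
      (hperm.nodup_iff.2 hcn) (fun u hu => ((hcandm u).1 (hperm.mem_iff.1 hu)).1)
      (fun u hu => ((hcandm u).1 (hperm.mem_iff.1 hu)).2.2)
    have hd := h.one_le_maxDegree
    have hPX := h.length_add_le
    have hRd := h.free.length_le_maxDegree
    have hRq := h.free.length_le_maxCliqueSize h.two_le
    -- Each clique found by the loop contains a candidate outside R, so R is not visited again.
    have hR : ∀ c ∈ new, c.R.toFinset ≠ R.toFinset := by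
      intro c hc he
      obtain ⟨-, u, hu, huc⟩ := hS.target c hc
      rw [he, List.mem_toFinset] at huc
      exact h.notMem (.inl ((hcandm u).1 (hperm.mem_iff.1 hu)).1) huc
    refine ⟨new ++ [⟨R, P ++ X, cand.isEmpty⟩], ?_, ?_, ?_, ?_, ?_, ?_, ?_⟩
    · simp only [gce, bind_val, step_val, append_val, List.append_nil]
      rw [List.append_assoc]
      exact hv
    · have hstep : (A.gce t F (n + 1) R P X out).steps =
          (R.length + 1) + ((P.length + 1) + (Qt.steps + ((A.del t R P X).steps +
            ((Timed.diff P D).steps + ((Timed.diff P' Qt.val).steps + (1 +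
            (gceLoop L t R (A.gce t F n) (A.order t R cand) P X
              (⟨R, P ++ X, cand.isEmpty⟩ :: out)).steps)))))) := by
        simp only [gce, bind_steps, step_val, step_steps, append_val, append_steps,
          List.append_nil]
        rfl
      have h1 : Qt.steps ≤ (2 * R.length + 2) * P.length + 1 :=
        filter_steps_le _ _ (fun u => any_steps_le _ 1 (fun _ => le_rfl) _) _
      have h2 := A.del_steps_le t R P X
      have h3 := diff_steps_le P D
      have h4 := diff_steps_le P' Qt.val
      have hDl : D.length ≤ P.length := by
        rcases A.del_eq_nil_or t R P X with h | h
        · simp [hD, h]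
        · exact h.1
      have hP'l : P'.length ≤ P.length := by
        rw [hP', diff_val]
        exact List.length_filter_le _ _
      have hQl : Qt.val.length ≤ P.length := by
        rw [hQt, filter_val]
        exact List.length_filter_le _ _
      rw [hstep, List.length_append, List.length_singleton]
      generalize L.maxDegree = d at *
      have hPd : P.length ≤ d := by omega
      -- |R| ≤ d + 1 and d ≥ 1.
      have hR2 : R.length ≤ 2 * d := by omega
      have hdd : d ≤ d ^ 2 := Nat.le_self_pow two_ne_zero d
      have e1 : (2 * R.length + 2) * P.length ≤ (2 * (2 * d) + 2) * d := by gcongr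
      have e2 : R.length ^ 2 ≤ (2 * d) ^ 2 := by gcongr
      have e3 : (2 * R.length + 9 * P.length + 11) * (P.length + X.length) ≤
        (2 * (2 * d) + 9 * d + 11) * d := by gcongr
      have e4 : (2 * D.length + 3) * P.length ≤ (2 * d + 3) * d := by
        gcongr; omega
      have e5 : (2 * Qt.val.length + 3) * P'.length ≤ (2 * d + 3) * d := by
        gcongr <;> omega
      -- The call's own work has to fit in 91d²: its share 100d² minus the reserve 9d² owed to the
      -- caller.
      nlinarith
    · intro c hc
      rcases List.mem_append.1 hc with hc | hc
      · exact hS.valid c hc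
      · rw [List.mem_singleton.1 hc]
        exact ⟨h.two_le, h.free, by simpa using hPX⟩
    · intro c hc
      rcases List.mem_append.1 hc with hc | hc
      · exact (hS.target c hc).1
      · rw [List.mem_singleton.1 hc]
        exact ⟨fun u hu => List.mem_toFinset.2 hu, fun u hu => .inl (List.mem_toFinset.1 hu)⟩
    · rw [List.map_append, List.nodup_append']
      refine ⟨hS.nodup, by simp, fun C hC hC' => ?_⟩
      obtain ⟨c, hc, rfl⟩ := List.mem_map.1 hC
      exact hR c hc (by simpa using hC')
    · have hlen := hS.length_le
      -- Since |R| ≤ q, the factor is one more than in the loop. The extra unit pays for this call: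
      -- by the call itself if it is a leaf, otherwise by a leaf below it.
      rw [List.length_append, List.countP_append, List.length_singleton, Nat.succ_sub hRq]
      by_cases hc : cand = []
      · have : new = [] := by
          refine List.eq_nil_iff_forall_not_mem.2 fun c hcn => ?_
          obtain ⟨-, u, hu, -⟩ := hS.target c hcn
          simpa [hc] using hperm.mem_iff.1 hu
        simp [this, hc]
      · have hne : new ≠ [] := hnew fun h => hc (by simpa [h] using hperm)
        have hpos : 0 < new.countP Call.isLeaf := by
          have := List.length_pos_iff.2 hne
          by_contra h0
          have h0 : new.countP Call.isLeaf = 0 := by omega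
          rw [h0] at hlen
          omega
        rw [Nat.succ_mul, mul_add]
        omega
    · intro M hM hA hT
      by_cases hMR : R.toFinset = M
      · refine ⟨⟨R, P ++ X, cand.isEmpty⟩, by simp, ?_, hMR⟩
        refine List.isEmpty_iff.2 (List.eq_nil_iff_forall_not_mem.2 fun u hu => ?_)
        -- A candidate would be adjacent to all of M = R.
        refine hM.not_adj u fun v hv => (h.adj u (.inl ((hcandm u).1 hu).1) v ?_).symm
        rwa [← hMR, List.mem_toFinset] at hv
      · have hMP : ∀ u ∈ M, u ∉ R → u ∈ P ∧ ∀ v ∈ R, s(u, v) ∉ F := fun u hu huR =>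
          ⟨(hT.2 u hu).resolve_left huR, fun v hv => hA u hu v (hT.1 v hv)
            (ne_of_mem_of_not_mem hv huR).symm⟩
        suffices ∃ u ∈ M, u ∉ R ∧ u ∉ D by
          obtain ⟨u, hu, huR, huD⟩ := this
          have := hMP u hu huR
          obtain ⟨c, hc, h⟩ := hS.cover M hM hA ⟨hT, u,
            hperm.mem_iff.2 ((hcandm u).2 ⟨this.1, huD, this.2⟩), hu⟩
          exact ⟨c, List.mem_append_left _ hc, h⟩
        -- If every vertex of M \ R is skipped, either nothing is skipped at all and M = R, or the
        -- pivot is adjacent to R and to M \ R, against maximality of M.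
        by_contra! hall
        rcases A.del_eq_nil_or t R P X with hnil | ⟨-, p, hp, hadj⟩
        · refine hMR (Finset.ext fun u => List.mem_toFinset.trans ⟨hT.1 u, fun hu => ?_⟩)
          by_contra huR
          have := hall u hu huR
          simp [hD, hnil] at this
        · refine hM.not_adj p fun u hu => ?_
          by_cases huR : u ∈ R
          · exact (h.adj p hp u huR).symm
          · exact hadj u (hall u hu huR)

end Implementation

/-! ### Summation over the links and the instants. -/

namespace Implementation

open Timed

variable {V : Type*} [DecidableEq V] {L : LinkStream V} (A : Implementation L)

/-- A clique may contain several links beginning at t; the set F ensures that it is visited only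
from the first of them in the loop order. The factor is q + 1 - 2 because the root cliques have two
vertices. -/
theorem linkLoop_spec (t : ℝ) (ls : List (Link V)) (F : Finset (Sym2 V)) (out : List (Call V))
    (hls : ls.Nodup) (hE : ∀ l ∈ ls, l ∈ L.E ∧ l.b = t) (hF : ∀ l ∈ ls, s(l.u, l.v) ∉ F) :
    ∃ new, (A.linkLoop t ls F out).val = new ++ out ∧
      (A.linkLoop t ls F out).steps ≤ 100 * L.maxDegree ^ 2 * new.length + 1 ∧
      ls.length ≤ new.length ∧
      IsSearch L t F (fun C => ∃ l ∈ ls, l.u ∈ C ∧ l.v ∈ C) (L.maxCliqueSize + 1 - 2) new := by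
  induction ls generalizing F out with
  | nil => exact ⟨[], rfl, le_rfl, le_rfl, ⟨by simp, by simp, by simp, by simp, by simp⟩⟩
  | cons l ls ih =>
    obtain ⟨hl, hls⟩ := List.nodup_cons.1 hls
    obtain ⟨hlE, rfl⟩ := hE l (by simp)
    have hlI : ∀ l' ∈ l :: ls, l.b ∈ l'.interval := fun l' hl' => by
      rw [← (hE l' hl').2]
      exact ⟨le_rfl, L.b_le_e l' (hE l' hl').1⟩
    have hadj : (L.graphAt l.b).Adj l.u l.v := ⟨l, hlE, .inl ⟨rfl, rfl⟩, hlI l (by simp)⟩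
    set P := (Timed.filter (isNbr L l.b l.v) (A.nbrs l.b l.u)).val with hP
    have hPm : ∀ w, w ∈ P ↔ (L.graphAt l.b).Adj l.u w ∧ (L.graphAt l.b).Adj l.v w := fun w => by
      rw [hP, mem_filter_isNbr, A.mem_nbrs]
    have hst : IsState L l.b F [l.u, l.v] P [] := by
      refine ⟨le_rfl, ?_, ?_, fun w hw v hv => ?_⟩
      · simpa [IsFreeClique] using ⟨hadj, hF l (by simp)⟩
      · rw [List.append_nil, hP, filter_val]
        exact (A.nbrs_nodup _ _).filter _
      · have := (hPm w).1 (by simpa using hw)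
        rcases List.mem_pair.1 hv with rfl | rfl
        exacts [this.1.symm, this.2.symm]
    obtain ⟨a, hav, has, ha⟩ := A.gce_spec l.b F (P.length + 1) [l.u, l.v] P [] out hst
      (Nat.lt_succ_self _)
    have hF' : ∀ l' ∈ ls, s(l'.u, l'.v) ∉ insert s(l.u, l.v) F := by
      intro l' hl' hm
      rcases Finset.mem_insert.1 hm with he | hm
      -- Two links on the same pair beginning at the same instant coincide by simplicity, so the new
      -- forbidden edge blocks no later root.
      · refine hl ((?_ : l' = l) ▸ hl')
        refine LinkStream.eq_of_joins (hE l' (by simp [hl'])).1 hlE (u := l.u) (v := l.v) ?_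
          (.inl ⟨rfl, rfl⟩) (hlI l' (by simp [hl'])) (hlI l (by simp))
        exact Sym2.eq_iff.1 he
      · exact hF l' (by simp [hl']) hm
    obtain ⟨b, hbv, hbs, hbl, hb⟩ := ih (insert s(l.u, l.v) F) (a ++ out) hls
      (fun l' hl' => hE l' (by simp [hl'])) hF'
    have hd := hst.one_le_maxDegree
    refine ⟨b ++ a, ?_, ?_, ?_, ?_⟩
    · simp only [linkLoop, bind_val, step_val]
      rw [hav, hbv, List.append_assoc]
    · simp only [linkLoop, bind_steps, step_val, step_steps]
      rw [hav]
      have h1 := filter_steps_le (isNbr L l.b l.v) 1 (fun _ => le_rfl) (A.nbrs l.b l.u)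
      have h2 : (A.nbrs l.b l.u).length ≤ L.maxDegree :=
        LinkStream.length_le_maxDegree (A.nbrs_nodup _ _) fun w hw => (A.mem_nbrs _ _ _).1 hw
      rw [List.length_append]
      nlinarith
    · have : 0 < a.length := by
        by_contra h0
        have h0 : a.length = 0 := by omega
        rw [h0] at has
        nlinarith
      rw [List.length_append, List.length_cons]
      omega
    · refine ha.append hb (Finset.subset_insert _ _) ?_ ?_ ?_ ?_
      · rintro c - ⟨h, -⟩
        exact ⟨l, by simp, h _ (by simp), h _ (by simp)⟩
      · rintro c - ⟨l', hl', h⟩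
        exact ⟨l', by simp [hl'], h⟩
      -- Later calls avoid the edge of l, which is now forbidden.
      · rintro c hc ⟨h, -⟩
        exact ((hb.valid c hc).free.adj (List.mem_toFinset.1 (h l.u (by simp)))
          (List.mem_toFinset.1 (h l.v (by simp))) (L.loopless l hlE)).2
          (Finset.mem_insert_self _ _)
      · rintro M hM hA ⟨l', hl', h'⟩
        by_cases h : l.u ∈ M ∧ l.v ∈ M
        · refine .inl ⟨fun w hw => ?_, fun w hw => ?_⟩
          · rcases List.mem_pair.1 hw with rfl | rfl
            exacts [h.1, h.2]
          · rw [or_iff_not_imp_left, List.mem_pair, not_or, hPm]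
            exact fun hne => ⟨hM.adj _ h.1 _ hw (Ne.symm hne.1), hM.adj _ h.2 _ hw (Ne.symm hne.2)⟩
        · refine .inr ⟨⟨l', (List.mem_cons.1 hl').resolve_left ?_, h'⟩, fun u hu v hv huv hm => ?_⟩
          · rintro rfl
            exact h h'
          · rcases Finset.mem_insert.1 hm with he | hm
            · rcases Sym2.eq_iff.1 he with ⟨rfl, rfl⟩ | ⟨rfl, rfl⟩
              exacts [h ⟨hu, hv⟩, h ⟨hv, hu⟩]
            · exact hA u hu v hv huv hm

theorem enumerate_spec (t : ℝ) :
    (A.enumerate t).steps ≤ 100 * L.maxDegree ^ 2 * (A.enumerate t).val.length + 2 ∧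
      (A.starting t).length ≤ (A.enumerate t).val.length ∧
      IsSearch L t ∅ (fun C => ∃ l ∈ A.starting t, l.u ∈ C ∧ l.v ∈ C) (L.maxCliqueSize + 1 - 2)
        (A.enumerate t).val := by
  obtain ⟨new, hv, hs, hl, h⟩ := A.linkLoop_spec t (A.starting t) ∅ [] (A.starting_nodup t)
    (fun l hl => (A.mem_starting t l).1 hl) (by simp)
  rw [List.append_nil] at hv
  have hv' : (A.enumerate t).val = new := hv
  rw [hv']
  refine ⟨?_, hl, h⟩
  simp only [enumerate, bind_steps, step_val, step_steps]
  omega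

omit [DecidableEq V] in
-- Testing one clique costs at most 8d² + 8d + 4 ≤ 20d², using |R| ≤ 2d and |N| ≤ d.
theorem testLoop_steps_le {t : ℝ} {F : Finset (Sym2 V)} (cs : List (Call V))
    (out : List (List V × ℝ × WithTop ℝ)) (h : ∀ c ∈ cs, IsValid L t F c) :
    (testLoop L t cs out).steps ≤ 20 * L.maxDegree ^ 2 * cs.length + 1 := by
  induction cs generalizing out with
  | nil => simp [testLoop]
  | cons c cs ih =>
    have hc := h c (by simp)
    simp only [testLoop, bind_steps, step_steps, cliqueEnd_steps, append_steps, List.length_cons]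
    have h1 := ih (if (Timed.all (fun u =>
        (minEnd L t u c.R).bind fun m =>
        (step (min m (cliqueEnd L t c.R).val)).bind fun e' =>
        step (decide (e' < (cliqueEnd L t c.R).val))) c.N).val then
          ((Timed.append c.R []).val, t, (cliqueEnd L t c.R).val) :: out else out)
      fun c hc => h c (by simp [hc])
    have h2 := all_steps_le (fun u =>
        (minEnd L t u c.R).bind fun m =>
        (step (min m (cliqueEnd L t c.R).val)).bind fun e' =>
        step (decide (e' < (cliqueEnd L t c.R).val))) (2 * c.R.length + 3) (fun u => by
          simp only [bind_steps, step_steps, minEnd_steps]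
          omega) c.N
    have hRd := hc.free.length_le_maxDegree
    have hN := hc.length_le
    have h3 := hc.two_le
    simp only [step_val] at h1 h2 ⊢
    generalize L.maxDegree = d at *
    have hdd : d ≤ d ^ 2 := Nat.le_self_pow two_ne_zero d
    have hd : 1 ≤ d := by omega
    have hR2 : c.R.length ≤ 2 * d := by omega
    have e1 : c.R.length ^ 2 ≤ (2 * d) ^ 2 := by gcongr
    have e2 : (2 * c.R.length + 3 + 1) * c.N.length ≤ (2 * (2 * d) + 3 + 1) * d := by gcongr
    nlinarith

theorem timeLoop_steps_le (ts : List ℝ) (out : List (List V × ℝ × WithTop ℝ)) :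
    (A.timeLoop ts out).steps ≤
      120 * L.maxDegree ^ 2 * (ts.map fun t => (A.enumerate t).val.length).sum +
        3 * ts.length + 1 := by
  induction ts generalizing out with
  | nil => simp [timeLoop]
  | cons t ts ih =>
    obtain ⟨h1, -, h2⟩ := A.enumerate_spec t
    have h3 := testLoop_steps_le (A.enumerate t).val out h2.valid
    have h4 := ih (testLoop L t (A.enumerate t).val out).val
    simp only [timeLoop, bind_steps, List.map_cons, List.sum_cons, List.length_cons]
    nlinarith

/-- Every link begins at some instant and triggers at least one call. With `length_times_le`, this
absorbs the constant overhead per instant into the number of calls. -/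
theorem card_le_sum_length :
    L.E.card ≤ (A.times.map fun t => (A.enumerate t).val.length).sum := by
  classical
  have h : L.E ⊆ (A.times.flatMap A.starting).toFinset := fun l hl => by
    rw [List.mem_toFinset, List.mem_flatMap]
    exact ⟨l.b, (A.mem_times _).2 ⟨l, hl, .inl rfl⟩, (A.mem_starting _ _).2 ⟨hl, rfl⟩⟩
  refine (Finset.card_le_card h).trans ((List.toFinset_card_le _).trans ?_)
  rw [List.length_flatMap]
  exact List.sum_le_sum fun t _ => (A.enumerate_spec t).2.1

omit [DecidableEq V] in
theorem length_times_le : A.times.length ≤ 2 * L.E.card := by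
  classical
  have h : A.times.toFinset ⊆ L.E.image Link.b ∪ L.E.image Link.e := fun t ht => by
    obtain ⟨l, hl, h⟩ := (A.mem_times t).1 (List.mem_toFinset.1 ht)
    rw [Finset.mem_union, Finset.mem_image, Finset.mem_image]
    exact h.imp (fun h => ⟨l, hl, h.symm⟩) (fun h => ⟨l, hl, h.symm⟩)
  rw [← List.toFinset_card_of_nodup A.times_nodup, two_mul]
  exact (Finset.card_le_card h).trans ((Finset.card_union_le _ _).trans
    (Nat.add_le_add Finset.card_image_le Finset.card_image_le))

theorem sum_length_le :
    (A.times.map fun t => (A.enumerate t).val.length).sum ≤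
      L.maxCliqueSize * A.leaves.length := by
  rw [leaves, List.length_flatMap, ← List.sum_map_mul_left]
  refine List.sum_le_sum fun t _ => (A.enumerate_spec t).2.2.length_le.trans ?_
  rw [List.length_map, ← List.countP_eq_length_filter]
  exact Nat.mul_le_mul_right _ (by omega)

/-- With S calls in total, the overhead is 3·|times| + 2 ≤ 6|E| + 2 ≤ 8S, whence 128 = 120 + 8. -/
theorem run_steps_le (hE : L.E.Nonempty) :
    A.run.steps ≤ 128 * L.maxDegree ^ 2 * (L.maxCliqueSize * A.leaves.length) := by
  obtain ⟨l, hl⟩ := hE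
  have hd : 1 ≤ L.maxDegree :=
    LinkStream.length_le_maxDegree (t := l.b) (u := l.u) (l := [l.v]) (by simp) fun w hw =>
      ⟨l, hl, .inl ⟨rfl, (List.mem_singleton.1 hw).symm⟩, le_rfl, L.b_le_e l hl⟩
  have h1 := A.timeLoop_steps_le A.times []
  have h2 := A.length_times_le
  have h3 := A.card_le_sum_length
  have h4 : 1 ≤ L.E.card := Finset.card_pos.2 ⟨l, hl⟩
  refine le_trans ?_ (Nat.mul_le_mul_left _ A.sum_length_le)
  simp only [run, bind_steps, step_steps, step_val]
  have h5 := Nat.mul_le_mul_right (A.times.map fun t => (A.enumerate t).val.length).sum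
    (Nat.one_le_pow 2 _ hd)
  rw [mul_assoc] at h1 ⊢
  omega

/-- The clique output by a call, with the time of the call. -/
def key (x : ℝ × Call V) : ℝ × Finset V := (x.1, x.2.R.toFinset)

/-! ### Counting leaves against maximal cliques. -/

theorem mem_leaves {x : ℝ × Call V} :
    x ∈ A.leaves ↔ x.1 ∈ A.times ∧ x.2 ∈ (A.enumerate x.1).val ∧ x.2.isLeaf = true := by
  simp only [leaves, List.mem_flatMap, List.mem_map, List.mem_filter]
  constructor
  · rintro ⟨t, ht, c, hc, rfl⟩
    exact ⟨ht, hc⟩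
  · rintro ⟨ht, hc⟩
    exact ⟨_, ht, _, hc, rfl⟩

/-- Within one instant the visited cliques are distinct; leaves of different instants differ in the
time. Leaves can therefore be counted by their keys. -/
theorem nodup_map_key_leaves : (A.leaves.map key).Nodup := by
  rw [leaves, List.map_flatMap, List.nodup_flatMap]
  constructor
  · intro t _
    rw [List.map_map]
    have := (A.enumerate_spec t).2.2.nodup.sublist
      (List.filter_sublist (p := fun c => c.isLeaf) |>.map _)
    rw [← List.nodup_map_iff (Prod.mk_right_injective t), List.map_map] at this
    exact this
  · refine A.times_nodup.imp fun {s t} hst => ?_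
    intro k hk hk'
    simp only [List.mem_map] at hk hk'
    obtain ⟨-, ⟨c, -, rfl⟩, rfl⟩ := hk
    obtain ⟨-, ⟨c', -, rfl⟩, he⟩ := hk'
    exact hst (congrArg Prod.fst he).symm

open Classical in
/-- The leaves that correspond to maximal cliques. -/
noncomputable def goodLeaves : List (ℝ × Call V) := A.leaves.filter fun x => decide (IsGood L x)

theorem mem_goodLeaves {x : ℝ × Call V} : x ∈ A.goodLeaves ↔ x ∈ A.leaves ∧ IsGood L x := by
  simp [goodLeaves]

theorem ratio_eq : A.ratio = (A.goodLeaves.length : ℝ) / (A.leaves.length : ℝ) := rfl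

theorem goodLeaves_sublist : A.goodLeaves.Sublist A.leaves := List.filter_sublist

theorem card_image_key {xs : List (ℝ × Call V)} (h : xs.Sublist A.leaves) :
    (xs.map key).toFinset.card = xs.length := by
  rw [List.toFinset_card_of_nodup (A.nodup_map_key_leaves.sublist (h.map _)), List.length_map]

theorem exists_isMaximalAt_leaf {t : ℝ} {M : Finset V} (hM : L.IsMaximalAt t M) {l : Link V}
    (hl : l ∈ L.E) (hb : l.b = t) (hu : l.u ∈ M) (hv : l.v ∈ M) :
    ∃ y ∈ A.goodLeaves, key y = (t, M) := by
  subst hb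
  obtain ⟨c, hc, hleaf, rfl⟩ := (A.enumerate_spec l.b).2.2.cover M hM (fun _ _ _ _ _ => by simp)
    ⟨l, (A.mem_starting _ _).2 ⟨hl, rfl⟩, hu, hv⟩
  exact ⟨(l.b, c), A.mem_goodLeaves.2 ⟨A.mem_leaves.2
    ⟨(A.mem_times _).2 ⟨l, hl, .inl rfl⟩, hc, hleaf⟩, hM.isMaximalClique hl hu hv⟩, rfl⟩

/-- Each leaf's clique extends to a maximal clique of G_t, which still contains the link beginning
at t and so is the clique of a good leaf at the same instant. That good leaf is charged by at most
as many leaves as its clique has subsets. -/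
theorem length_leaves_le :
    A.leaves.length ≤ A.goodLeaves.length * 2 ^ L.maxCliqueSize := by
  classical
  rw [← A.card_image_key (List.Sublist.refl _), ← A.card_image_key A.goodLeaves_sublist]
  refine (Finset.card_le_card (t := (A.goodLeaves.map key).toFinset.biUnion fun k =>
    k.2.powerset.image fun C => (k.1, C)) ?_).trans
    (Finset.card_biUnion_le_card_mul _ _ _ ?_)
  · intro k hk
    obtain ⟨x, hx, rfl⟩ := List.mem_map.1 (List.mem_toFinset.1 hk)
    obtain ⟨ht, hc, -⟩ := A.mem_leaves.1 hx
    have hS := (A.enumerate_spec x.1).2.2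
    obtain ⟨l, hl, hu, hv⟩ := hS.target _ hc
    obtain ⟨hlE, hb⟩ := (A.mem_starting _ _).1 hl
    have hV := hS.valid _ hc
    obtain ⟨M, hRM, hM⟩ := LinkStream.exists_isMaximalAt (L := L) (t := x.1)
      (C := x.2.R.toFinset) (by rw [List.toFinset_card_of_nodup hV.free.nodup]; exact hV.two_le)
      fun u hu v hv huv =>
        (hV.free.adj (List.mem_toFinset.1 hu) (List.mem_toFinset.1 hv) huv).1
    obtain ⟨y, hy, hyk⟩ := A.exists_isMaximalAt_leaf hM hlE hb (hRM hu) (hRM hv)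
    refine Finset.mem_biUnion.2 ⟨key y, List.mem_toFinset.2 (List.mem_map_of_mem hy), ?_⟩
    rw [hyk]
    exact Finset.mem_image.2 ⟨_, Finset.mem_powerset.2 hRM, rfl⟩
  · intro k hk
    obtain ⟨x, hx, rfl⟩ := List.mem_map.1 (List.mem_toFinset.1 hk)
    obtain ⟨t₁, -, hmax⟩ := (A.mem_goodLeaves.1 hx).2
    refine Finset.card_image_le.trans ?_
    rw [Finset.card_powerset]
    exact Nat.pow_le_pow_right two_pos hmax.1.1.card_le

theorem length_goodLeaves_le : A.goodLeaves.length ≤ L.numMaximalCliques := by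
  classical
  rw [← A.card_image_key A.goodLeaves_sublist, ← Set.ncard_coe_finset]
  refine Set.ncard_le_ncard_of_injOn
    -- The default 0 is never used: the final time of a good leaf is finite.
    (fun k => (k.2, k.1, (L.finalTime k.1 k.2).untopD 0)) ?_ ?_ L.finite_isMaximalClique
  · intro k hk
    obtain ⟨x, hx, rfl⟩ := List.mem_map.1 (List.mem_toFinset.1 hk)
    obtain ⟨t₁, ht₁, hmax⟩ := (A.mem_goodLeaves.1 hx).2
    simpa [key, ht₁] using hmax
  · rintro ⟨s, C⟩ - ⟨t, D⟩ - h
    simp only [Prod.mk.injEq] at h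
    rw [h.1, h.2.1]

/-- Ensures r > 0, so that 1/r is a genuine quotient and not the convention 1/0 = 0. -/
theorem length_goodLeaves_pos (hE : L.E.Nonempty) : 0 < A.goodLeaves.length := by
  obtain ⟨l, hl⟩ := hE
  obtain ⟨M, hM, hmax⟩ := LinkStream.exists_isMaximalAt (L := L) (t := l.b) (C := {l.u, l.v})
    (by rw [Finset.card_pair (L.loopless l hl)]) (by
      have : (L.graphAt l.b).Adj l.u l.v := ⟨l, hl, .inl ⟨rfl, rfl⟩, le_rfl, L.b_le_e l hl⟩
      have := this.symm
      simp +contextual [*])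
  obtain ⟨y, hy, -⟩ := A.exists_isMaximalAt_leaf hmax hl rfl (hM (by simp)) (hM (by simp))
  exact List.length_pos_of_mem hy

theorem one_div_ratio : 1 / A.ratio = (A.leaves.length : ℝ) / A.goodLeaves.length := by
  rw [ratio_eq, one_div_div]

end Implementation

theorem theorem4 :
    (∀ (V : Type*) [DecidableEq V] (L : LinkStream V) (A : Implementation L),
      L.E.Nonempty → 1 ≤ 1 / A.ratio ∧ 1 / A.ratio ≤ (2 : ℝ) ^ L.maxCliqueSize) ∧
    ∃ c : ℝ, ∀ (V : Type*) [DecidableEq V] (L : LinkStream V) (A : Implementation L),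
      L.E.Nonempty →
        (A.run.steps : ℝ) ≤
          c * (1 / A.ratio * (L.maxDegree : ℝ) ^ 2 * (L.maxCliqueSize : ℝ) *
            (L.numMaximalCliques : ℝ)) := by
  refine ⟨fun V _ L A hE => ?_, 128, fun V _ L A hE => ?_⟩
  · have hpos : (0 : ℝ) < A.goodLeaves.length := by exact_mod_cast A.length_goodLeaves_pos hE
    rw [A.one_div_ratio, one_le_div₀ hpos, div_le_iff₀' hpos]
    exact ⟨by exact_mod_cast A.goodLeaves_sublist.length_le,
      by exact_mod_cast A.length_leaves_le⟩
  · have hpos : (0 : ℝ) < A.goodLeaves.length := by exact_mod_cast A.length_goodLeaves_pos hE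
    have h1 : (A.run.steps : ℝ) ≤
        128 * (L.maxDegree : ℝ) ^ 2 * (L.maxCliqueSize * A.leaves.length) := by
      exact_mod_cast A.run_steps_le hE
    -- #leaves = (1/r) · #good leaves, and #good leaves ≤ α.
    have h2 : (A.leaves.length : ℝ) ≤ 1 / A.ratio * L.numMaximalCliques := by
      rw [A.one_div_ratio, div_mul_eq_mul_div, le_div_iff₀ hpos]
      gcongr
      exact_mod_cast A.length_goodLeaves_le
    calc (A.run.steps : ℝ)
        ≤ 128 * (L.maxDegree : ℝ) ^ 2 * (L.maxCliqueSize * A.leaves.length) := h1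
      _ ≤ 128 * (L.maxDegree : ℝ) ^ 2 *
          (L.maxCliqueSize * (1 / A.ratio * L.numMaximalCliques)) := by gcongr
      _ = _ := by ring
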